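/- Let $N\ge 1$, let $A\in\mathbb R^{n\times n}$, $B\in\mathbb R^{n\times m}$, $C\in\mathbb R^{p\times n}$, and write $\Sigma=(A,B,C)$. Let $\mathrm{He}\{X\}=X^T+X$; $X\succ 0$ ($X\prec 0$) means symmetric positive (negative) definite; $\otimes$ is the Kronecker product; $\mathbf e_{(k,i)}$ is the $i$-th unit vector of $\mathbb R^k$; $\mathcal L_k=[\,\mathbf I_k\ \mathbf 0_k\,]$ and $\mathcal R_k=[\,\mathbf 0_k\ \mathbf I_k\,]$ in $\mathbb R^{k\times(k+1)}$; $\mathbf T_N$ is the $N\times N$ matrix with ones on the antidiagonal and zeros elsewhere. For symmetric $P\in\mathbb R^{n\times n}$ put $$\mathcal X_N(P)=\big(-\mathbf e_{(N+1,1)}\mathbf e_{(N+1,1)}^T+\mathbf e_{(N+1,N+1)}\mathbf e_{(N+1,N+1)}^T\big)\otimes P,\qquad \Pi_N=\begin{bmatrix}\mathbf e_{(N,1)}^T\otimes \mathbf I_n&\mathbf 0\\ \mathbf I_N\otimes A&\mathbf I_N\otimes B\end{bmatrix}.$$ An output-feedback gain matrix is a block lower triangular matrix $\mathcal F\in\mathbb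 R^{Nm\times Np}$ with $m\times p$ blocks: its block in row $i$ and column $j$ ($0\le j\le i\le N-1$) is an arbitrary matrix $F^{(i,\,i-j)}$, and its other blocks are zero. It represents the controller $u(k)=\sum_{i=0}^{k \bmod N}F^{(k\bmod N,\,i)}y(k-i)$ for $x(k+1)=Ax(k)+Bu(k)$, $y(k)=Cx(k)$. For $1\le\delta\le N$ let $\mathcal F^{(\delta)}$ be its leading $\delta\times\delta$ block part, let $\Phi_0=\mathbf I_n$, and define recursively $$\mathcal A_\delta=[\,\mathbf 0\ \ \mathbf I_n\,]\big(\mathbf I_\delta\otimes A+(\mathbf I_\delta\otimes B)\mathcal F^{(\delta)}(\mathbf I_\delta\otimes C)\big)\Phi_{\delta-1},\qquad \Phi_\delta=\begin{bmatrix}\Phi_{\delta-1}\\ \mathcal A_\delta\end{bmatrix},\qquad \mathcal A_{\rm LTI}(\mathcal F,\Sigma)=\mathcal A_N,$$ so that $x(N(t+1))=\mathcal A_{\rm LTI}(\mathcal F,\Sigma)\,x(Nt)$ in closed loop. For a state-feedback gain $\mathcal F\in\mathbb R^{Nm\times Nn}$, $\mathcal A_{\rm LTI}(\mathcal F,\Sigma)$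 is defined in the same way with $p=n$ and $C$ replaced by $\mathbf I_n$. For a square matrix $S\in\mathbb R^{n\times n}$ let $\mathcal P(S)=\{P\succ 0: S^TPS-P\prec 0\}$, and let $\mathcal S^{(N)}_{\rm SOF}(\Sigma)$ be the union of $\mathcal P(\mathcal A_{\rm LTI}(\mathcal F,\Sigma))$ over all output-feedback gain matrices $\mathcal F$ for which $\mathcal A_{\rm LTI}(\mathcal F,\Sigma)$ has spectral radius less than $1$. Suppose that $\hat P=\hat P^T\in\mathbb R^{n\times n}$ and the block upper triangular matrices $\hat{\mathcal J}\in\mathbb R^{Nm\times Nn}$ ($m\times n$ blocks) and $\hat{\mathcal G}\in\mathbb R^{Nn\times Nn}$ ($n\times n$ blocks) satisfy Ebihara's LMI $$\mathcal X_N(\hat P)+\mathrm{He}\big\{(\mathcal L_N^T\otimes A)\hat{\mathcal G}(\mathcal R_N\otimes \mathbf I_n)+(\mathcal L_N^T\otimes B)\hat{\mathcal J}(\mathcal R_N\otimes \mathbf I_n)-(\mathcal R_N^T\otimes \mathbf I_n)\hat{\mathcal G}(\mathcal R_N\otimes \mathbf I_n)\big\}\prec 0$$ (which forces $\hat{\mathcal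 G}$ to be invertible), and let $\hat{\mathcal F}_{\rm SF}=(\mathbf T_N\otimes \mathbf I_m)\hat{\mathcal J}\hat{\mathcal G}^{-1}(\mathbf T_N\otimes \mathbf I_n)$. Put $$\mathcal H(\hat{\mathcal F}_{\rm SF})=\begin{bmatrix}\hat{\mathcal F}_{\rm SF}&-\mathbf I_{Nm}\\ \mathcal L_{N-1}\otimes A-\mathcal R_{N-1}\otimes \mathbf I_n&\mathcal L_{N-1}\otimes B\end{bmatrix},\qquad \mathcal C(\mathcal F)=\begin{bmatrix}\mathcal F(\mathbf I_N\otimes C)&-\mathbf I_{Nm}\\ \mathcal L_{N-1}\otimes A-\mathcal R_{N-1}\otimes \mathbf I_n&\mathcal L_{N-1}\otimes B\end{bmatrix}.$$ Then there exist a symmetric $P\in\mathbb R^{n\times n}$, a matrix $\mathcal V\in\mathbb R^{((N-1)n+Nm)\times((N-1)n+Nm)}$ and an output-feedback gain matrix $\mathcal F_{\rm SOF}\in\mathbb R^{Nm\times Np}$ such that $$P\succ 0,\qquad \Pi_N^T\mathcal X_N(P)\Pi_N+\mathrm{He}\{\mathcal H(\hat{\mathcal F}_{\rm SF})^T\,\mathcal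 V\,\mathcal C(\mathcal F_{\rm SOF})\}\prec 0$$ if and only if $$\mathcal P\big(\mathcal A_{\rm LTI}(\hat{\mathcal F}_{\rm SF},\Sigma)\big)\cap\mathcal S^{(N)}_{\rm SOF}(\Sigma)\neq\emptyset .$$ -/

import Mathlib

open scoped Matrix Kronecker

namespace PTVM

noncomputable section

/-! ### Notation for matrices -/

/-- `He{A} = Aᵀ + A`. -/
def He {ι : Type*} (A : Matrix ι ι ℝ) : Matrix ι ι ℝ := Aᵀ + A

/-- `A ≺ 0`: the real matrix `A` is symmetric and negative definite. -/
def NegDef {ι : Type*} (A : Matrix ι ι ℝ) : Prop := (-A).PosDef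

/-- The `k × l` matrix with ones at the positions `(i, i)` and zeros elsewhere.  The matrix
`ℒ_N = [I_N 0_N]` is `leftSel N (N + 1)`, and `ℒ_{N-1}` is `leftSel (N - 1) N`. -/
def leftSel (k l : ℕ) : Matrix (Fin k) (Fin l) ℝ :=
  Matrix.of fun i j => if (j : ℕ) = (i : ℕ) then 1 else 0

/-- The `k × l` matrix with ones at the positions `(i, i + 1)` and zeros elsewhere.  The matrix
`ℛ_N = [0_N I_N]` is `rightSel N (N + 1)`, and `ℛ_{N-1}` is `rightSel (N - 1) N`. -/
def rightSel (k l : ℕ) : Matrix (Fin k) (Fin l) ℝ :=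
  Matrix.of fun i j => if (j : ℕ) = (i : ℕ) + 1 then 1 else 0

/-- The unit vector `e_{(N, i)}` of dimension `N`; the components are counted from `1`. -/
def unitVec (N i : ℕ) : Fin N → ℝ := fun j => if (j : ℕ) + 1 = i then 1 else 0

/-- The `N × N` matrix `T_N` with ones on the antidiagonal. -/
def flip (N : ℕ) : Matrix (Fin N) (Fin N) ℝ :=
  Matrix.of fun i j => if (i : ℕ) + (j : ℕ) + 1 = N then 1 else 0

/-- An `N × N` block matrix with blocks of size `a × b` that is block upper triangular. -/
def IsBlockUpper {N a b : ℕ} (G : Matrix (Fin N × Fin a) (Fin N × Fin b) ℝ) : Prop :=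
  ∀ i j : Fin N, j < i → ∀ (r : Fin a) (c : Fin b), G (i, r) (j, c) = 0

/-! ### Memory feedback gains and the lifted time-invariant system -/

/-- The gain matrix `𝓕^{(N,↓)}` assembled from the gains `F^{(i,j)}` of the periodic memory
controller `u(k) = ∑_{i=0}^{k mod N} F^{(k mod N, i)} y(k - i)`: the block in row `i` and column
`j` is `F^{(i, i-j)}` for `j ≤ i` and zero for `j > i`. -/
def gainDown {N m p : ℕ} (F : Fin N → Fin N → Matrix (Fin m) (Fin p) ℝ) :
    Matrix (Fin N × Fin m) (Fin N × Fin p) ℝ :=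
  Matrix.of fun r c =>
    if r.1 < c.1 then 0
    else F r.1 ⟨(r.1 : ℕ) - (c.1 : ℕ), lt_of_le_of_lt (Nat.sub_le _ _) r.1.isLt⟩ r.2 c.2

/-- The leading part `𝓕^{(δ,↓)}` of `𝓕^{(N,↓)}`, made of the first `δ` block rows and columns. -/
def truncGain {N m p : ℕ} (F : Matrix (Fin N × Fin m) (Fin N × Fin p) ℝ) (δ : ℕ) (h : δ ≤ N) :
    Matrix (Fin δ × Fin m) (Fin δ × Fin p) ℝ :=
  F.submatrix (fun r => (Fin.castLE h r.1, r.2)) (fun c => (Fin.castLE h c.1, c.2))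

/-- `𝒜_AUG^{(δ,↓)} = I_δ ⊗ A + (I_δ ⊗ B) 𝓕^{(δ,↓)} (I_δ ⊗ C)`. -/
def augMatrix {N n m p : ℕ} (A : Matrix (Fin n) (Fin n) ℝ) (B : Matrix (Fin n) (Fin m) ℝ)
    (C : Matrix (Fin p) (Fin n) ℝ) (F : Matrix (Fin N × Fin m) (Fin N × Fin p) ℝ)
    (δ : ℕ) (h : δ ≤ N) : Matrix (Fin δ × Fin n) (Fin δ × Fin n) ℝ :=
  (1 : Matrix (Fin δ) (Fin δ) ℝ) ⊗ₖ A
    + ((1 : Matrix (Fin δ) (Fin δ) ℝ) ⊗ₖ B) * truncGain F δ h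
      * ((1 : Matrix (Fin δ) (Fin δ) ℝ) ⊗ₖ C)

/-- The block column `[I_n; 𝒜_LTI(𝓕^{(1,↓)}); …; 𝒜_LTI(𝓕^{(δ,↓)})]`, built recursively: the block
`𝒜_LTI(𝓕^{(δ+1,↓)})` is the last block row of `𝒜_AUG^{(δ+1,↓)}` times the column built before. -/
def stackLTI {N n m p : ℕ} (A : Matrix (Fin n) (Fin n) ℝ) (B : Matrix (Fin n) (Fin m) ℝ)
    (C : Matrix (Fin p) (Fin n) ℝ) (F : Matrix (Fin N × Fin m) (Fin N × Fin p) ℝ) :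
    (δ : ℕ) → δ ≤ N → Matrix (Fin (δ + 1) × Fin n) (Fin n) ℝ
  | 0, _ => Matrix.of fun r c => (1 : Matrix (Fin n) (Fin n) ℝ) r.2 c
  | δ + 1, h => Matrix.of fun r c =>
      Fin.lastCases (motive := fun _ => ℝ)
        ((augMatrix A B C F (δ + 1) h * stackLTI A B C F δ (Nat.le_of_succ_le h))
          (Fin.last δ, r.2) c)
        (fun i => stackLTI A B C F δ (Nat.le_of_succ_le h) (i, r.2) c) r.1

/-- `𝒜_LTI(𝓕^{(N,↓)}, Σ)`, the transition matrix from `x(Nt)` to `x(N(t+1))` of the closed loop of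
`Σ = (A, B, C)` with the memory output feedback gain `𝓕^{(N,↓)}`. -/
def aLTI {N n m p : ℕ} (A : Matrix (Fin n) (Fin n) ℝ) (B : Matrix (Fin n) (Fin m) ℝ)
    (C : Matrix (Fin p) (Fin n) ℝ) (F : Matrix (Fin N × Fin m) (Fin N × Fin p) ℝ) :
    Matrix (Fin n) (Fin n) ℝ :=
  Matrix.of fun a b => stackLTI A B C F N le_rfl (Fin.last N, a) b

/-- `𝒜_LTI` for a memory state-feedback gain, that is, for `y = x`. -/
def aLTIState {N n m : ℕ} (A : Matrix (Fin n) (Fin n) ℝ) (B : Matrix (Fin n) (Fin m) ℝ)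
    (F : Matrix (Fin N × Fin m) (Fin N × Fin n) ℝ) : Matrix (Fin n) (Fin n) ℝ :=
  aLTI A B (1 : Matrix (Fin n) (Fin n) ℝ) F

/-! ### Lyapunov matrices -/

/-- `𝒫(A)`: the positive definite `P` with `Aᵀ P A - P ≺ 0`. -/
def lyapSet {n : ℕ} (A : Matrix (Fin n) (Fin n) ℝ) : Set (Matrix (Fin n) (Fin n) ℝ) :=
  {P | P.PosDef ∧ NegDef (Aᵀ * P * A - P)}

/-- `ℒ_SOF^{(N)}(Σ)`: the stabilizing memory output feedback gain matrices, for which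
`𝒜_LTI(𝓕, Σ)` has (complex) spectral radius less than one. -/
def stabSOF (N : ℕ) {n m p : ℕ} (A : Matrix (Fin n) (Fin n) ℝ) (B : Matrix (Fin n) (Fin m) ℝ)
    (C : Matrix (Fin p) (Fin n) ℝ) : Set (Matrix (Fin N × Fin m) (Fin N × Fin p) ℝ) :=
  {F | F ∈ Set.range gainDown ∧ spectralRadius ℂ ((aLTI A B C F).map (algebraMap ℝ ℂ)) < 1}

/-- `𝒮_SOF^{(N)}(Σ) = ⋃_{𝓕 ∈ ℒ_SOF^{(N)}(Σ)} 𝒫(𝒜_LTI(𝓕, Σ))`. -/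
def lyapSOF (N : ℕ) {n m p : ℕ} (A : Matrix (Fin n) (Fin n) ℝ) (B : Matrix (Fin n) (Fin m) ℝ)
    (C : Matrix (Fin p) (Fin n) ℝ) : Set (Matrix (Fin n) (Fin n) ℝ) :=
  ⋃ F ∈ stabSOF N A B C, lyapSet (aLTI A B C F)

/-! ### The matrix inequalities -/

/-- `𝒳_δ(P, γ) = (-γ e_{(N+1,1)} e_{(N+1,1)}ᵀ + e_{(N+1,δ+1)} e_{(N+1,δ+1)}ᵀ) ⊗ P`. -/
def xMat (N δ : ℕ) {n : ℕ} (P : Matrix (Fin n) (Fin n) ℝ) (γ : ℝ) :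
    Matrix (Fin (N + 1) × Fin n) (Fin (N + 1) × Fin n) ℝ :=
  (-(γ • Matrix.vecMulVec (unitVec (N + 1) 1) (unitVec (N + 1) 1))
    + Matrix.vecMulVec (unitVec (N + 1) (δ + 1)) (unitVec (N + 1) (δ + 1))) ⊗ₖ P

/-- `Π_N = [[e_{(N,1)}ᵀ ⊗ I_n, 0], [I_N ⊗ A, I_N ⊗ B]]`; its rows are one block row, followed by
`N` block rows. -/
def piMat (N : ℕ) {n m : ℕ} (A : Matrix (Fin n) (Fin n) ℝ) (B : Matrix (Fin n) (Fin m) ℝ) :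
    Matrix (Fin (N + 1) × Fin n) ((Fin N × Fin n) ⊕ (Fin N × Fin m)) ℝ :=
  Matrix.of fun r c =>
    Fin.cases (motive := fun _ => ℝ)
      (Matrix.fromCols
        (Matrix.replicateRow Unit (unitVec N 1) ⊗ₖ (1 : Matrix (Fin n) (Fin n) ℝ))
        (0 : Matrix (Unit × Fin n) (Fin N × Fin m) ℝ) ((), r.2) c)
      (fun i => Matrix.fromCols
        ((1 : Matrix (Fin N) (Fin N) ℝ) ⊗ₖ A)
        ((1 : Matrix (Fin N) (Fin N) ℝ) ⊗ₖ B) (i, r.2) c) r.1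

/-- `ℋ(𝓕) = [[𝓕, -I_N ⊗ I_m], [ℒ_{N-1} ⊗ A - ℛ_{N-1} ⊗ I_n, ℒ_{N-1} ⊗ B]]`. -/
def hMat {N n m : ℕ} (A : Matrix (Fin n) (Fin n) ℝ) (B : Matrix (Fin n) (Fin m) ℝ)
    (F : Matrix (Fin N × Fin m) (Fin N × Fin n) ℝ) :
    Matrix ((Fin N × Fin m) ⊕ (Fin (N - 1) × Fin n)) ((Fin N × Fin n) ⊕ (Fin N × Fin m)) ℝ :=
  Matrix.fromBlocks
    F
    (-((1 : Matrix (Fin N) (Fin N) ℝ) ⊗ₖ (1 : Matrix (Fin m) (Fin m) ℝ)))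
    (leftSel (N - 1) N ⊗ₖ A - rightSel (N - 1) N ⊗ₖ (1 : Matrix (Fin n) (Fin n) ℝ))
    (leftSel (N - 1) N ⊗ₖ B)

/-- `𝒞(𝓕) = [[𝓕 (I_N ⊗ C), -I_N ⊗ I_m], [ℒ_{N-1} ⊗ A - ℛ_{N-1} ⊗ I_n, ℒ_{N-1} ⊗ B]]`. -/
def cMat {N n m p : ℕ} (A : Matrix (Fin n) (Fin n) ℝ) (B : Matrix (Fin n) (Fin m) ℝ)
    (C : Matrix (Fin p) (Fin n) ℝ) (F : Matrix (Fin N × Fin m) (Fin N × Fin p) ℝ) :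
    Matrix ((Fin N × Fin m) ⊕ (Fin (N - 1) × Fin n)) ((Fin N × Fin n) ⊕ (Fin N × Fin m)) ℝ :=
  Matrix.fromBlocks
    (F * ((1 : Matrix (Fin N) (Fin N) ℝ) ⊗ₖ C))
    (-((1 : Matrix (Fin N) (Fin N) ℝ) ⊗ₖ (1 : Matrix (Fin m) (Fin m) ℝ)))
    (leftSel (N - 1) N ⊗ₖ A - rightSel (N - 1) N ⊗ₖ (1 : Matrix (Fin n) (Fin n) ℝ))
    (leftSel (N - 1) N ⊗ₖ B)

/-- The bilinear matrix inequalities `P ≻ 0` and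
`Π_Nᵀ 𝒳_N(P, 1) Π_N + He{M 𝒞(𝓕)} ≺ 0` in the unknowns `P`, `M`, `𝓕`. -/
def BMI {N n m p : ℕ} (A : Matrix (Fin n) (Fin n) ℝ) (B : Matrix (Fin n) (Fin m) ℝ)
    (C : Matrix (Fin p) (Fin n) ℝ) (P : Matrix (Fin n) (Fin n) ℝ)
    (M : Matrix ((Fin N × Fin n) ⊕ (Fin N × Fin m)) ((Fin N × Fin m) ⊕ (Fin (N - 1) × Fin n)) ℝ)
    (F : Matrix (Fin N × Fin m) (Fin N × Fin p) ℝ) : Prop :=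
  P.PosDef ∧
    NegDef ((piMat N A B)ᵀ * xMat N N P 1 * piMat N A B + He (M * cMat A B C F))

/-- `(P, 𝓙, 𝓖)` is a solution of Ebihara's linear matrix inequality: `P` is symmetric, `𝓙` and `𝓖`
are block upper triangular, and
`𝒳_N(P, 1) + He{(ℒ_Nᵀ ⊗ A) 𝓖 (ℛ_N ⊗ I_n) + (ℒ_Nᵀ ⊗ B) 𝓙 (ℛ_N ⊗ I_n)
  - (ℛ_Nᵀ ⊗ I_n) 𝓖 (ℛ_N ⊗ I_n)} ≺ 0`. -/
structure EbiharaLMI {N n m : ℕ} (A : Matrix (Fin n) (Fin n) ℝ) (B : Matrix (Fin n) (Fin m) ℝ)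
    (P : Matrix (Fin n) (Fin n) ℝ) (J : Matrix (Fin N × Fin m) (Fin N × Fin n) ℝ)
    (G : Matrix (Fin N × Fin n) (Fin N × Fin n) ℝ) : Prop where
  symm : P.IsSymm
  upperJ : IsBlockUpper J
  upperG : IsBlockUpper G
  lmi : NegDef (xMat N N P 1 + He (
    ((leftSel N (N + 1))ᵀ ⊗ₖ A) * G
        * (rightSel N (N + 1) ⊗ₖ (1 : Matrix (Fin n) (Fin n) ℝ))
      + ((leftSel N (N + 1))ᵀ ⊗ₖ B) * J
        * (rightSel N (N + 1) ⊗ₖ (1 : Matrix (Fin n) (Fin n) ℝ))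
      - ((rightSel N (N + 1))ᵀ ⊗ₖ (1 : Matrix (Fin n) (Fin n) ℝ)) * G
        * (rightSel N (N + 1) ⊗ₖ (1 : Matrix (Fin n) (Fin n) ℝ))))

/-- The memory state-feedback gain `𝓕^{(N,↓)} = (T_N ⊗ I_m) 𝓙 𝓖⁻¹ (T_N ⊗ I_n)`. -/
def stateGain {N n m : ℕ} (J : Matrix (Fin N × Fin m) (Fin N × Fin n) ℝ)
    (G : Matrix (Fin N × Fin n) (Fin N × Fin n) ℝ) :
    Matrix (Fin N × Fin m) (Fin N × Fin n) ℝ :=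
  (flip N ⊗ₖ (1 : Matrix (Fin m) (Fin m) ℝ)) * J * G⁻¹
    * (flip N ⊗ₖ (1 : Matrix (Fin n) (Fin n) ℝ))

end

end PTVM

namespace PTVM

/-! ### The elimination lemma -/

section Elimination

variable {ι κ μ : Type*} [Fintype ι] [Fintype κ]

/-! Two facts carry the theorem. First, for a block lower triangular gain the kernel of `cMat` is
exactly the set of state-input trajectories of the closed loop over one period. On the trajectory
from `x₀`, the form `Πᵀ𝒳(P)Π` takes the value `(𝒜x₀)ᵀP(𝒜x₀) - x₀ᵀPx₀`. Hence, for `P ≻ 0`,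
membership in `𝒫(𝒜_LTI)` means negativity of this form on that kernel (`mem_lyapSet_aLTI_iff`).
Since `ℋ(𝓕)` is `𝒞(𝓕)` with `C = I`, this covers the state-feedback gain too.

Second, elimination (`exists_forall_dotProduct_neg`): a form negative on `ker H` and on `ker C`
becomes negative everywhere after adding `(Hz)ᵀV(Cz)` for a suitable `V`. The converse is immediate,
because the added term vanishes on both kernels. So, for fixed `P` and output gain, `V` exists iff
`P` is a Lyapunov matrix for both closed loops (`exists_BMI_iff`).

Two side conditions remain. A Lyapunov matrix bounds the spectral radius, so stability of the output
feedback is automatic. Ebihara's inequality enters only through the shape of the state gain: it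
makes the diagonal blocks of `𝓖` positive, so `𝓖⁻¹` exists and is block upper triangular, and the
flips turn `𝓙𝓖⁻¹` into a block lower triangular gain. -/

open scoped MatrixOrder in
-- This is the dual form of elimination. Write `W = YᵀY` and diagonalise `(YHᵀ)(YHᵀ)ᵀ` with
-- orthonormal eigenvectors `uᵢ`. Eigenvalue zero gives `HYᵀuᵢ = 0`; otherwise `uᵢ` lies in the
-- range of `YHᵀ`, which `CYᵀ` annihilates. Thus `W` is a sum of `wwᵀ` with each `w = Yᵀuᵢ` in one
-- of the two kernels.
theorem trace_mul_neg_of_posSemidef (Q : Matrix ι ι ℝ) (H : Matrix κ ι ℝ) (C : Matrix μ ι ℝ)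
    (hH : ∀ z, z ≠ 0 → H *ᵥ z = 0 → z ⬝ᵥ (Q *ᵥ z) < 0)
    (hC : ∀ z, z ≠ 0 → C *ᵥ z = 0 → z ⬝ᵥ (Q *ᵥ z) < 0)
    {W : Matrix ι ι ℝ} (hW : W.PosSemidef) (hW0 : W ≠ 0) (hCWH : C * W * Hᵀ = 0) :
    (Q * W).trace < 0 := by
  classical
  obtain ⟨Y, rfl⟩ := CStarAlgebra.nonneg_iff_eq_star_mul_self.mp hW.nonneg
  rw [Matrix.star_eq_conjTranspose, Matrix.conjTranspose_eq_transpose_of_trivial] at *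
  have hS : (Y * Hᵀ * (Y * Hᵀ)ᵀ).IsHermitian := by
    simp [Matrix.IsHermitian, Matrix.conjTranspose_eq_transpose_of_trivial, Matrix.mul_assoc]
  set U : Matrix ι ι ℝ := (hS.eigenvectorUnitary : Matrix ι ι ℝ) with hU
  have hUU : U * Uᵀ = 1 := by
    have := Unitary.coe_mul_star_self hS.eigenvectorUnitary
    rwa [Unitary.coe_star, Matrix.star_eq_conjTranspose, Matrix.conjTranspose_eq_transpose_of_trivial] at this
  have hcol : ∀ i, U.col i = ⇑(hS.eigenvectorBasis i) := fun i => rfl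
  have hker : ∀ i, H *ᵥ (Yᵀ *ᵥ U.col i) = 0 ∨ C *ᵥ (Yᵀ *ᵥ U.col i) = 0 := by
    intro i
    have he := hS.mulVec_eigenvectorBasis i
    rw [← hcol] at he
    by_cases hl : hS.eigenvalues i = 0
    · left
      rw [hl, zero_smul] at he
      have h2 : (H *ᵥ (Yᵀ *ᵥ U.col i)) ⬝ᵥ (H *ᵥ (Yᵀ *ᵥ U.col i)) = 0 := by
        have h3 : U.col i ⬝ᵥ ((Y * Hᵀ * (Y * Hᵀ)ᵀ) *ᵥ U.col i) = 0 := by rw [he, dotProduct_zero]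
        rwa [← Matrix.mulVec_mulVec, Matrix.dotProduct_mulVec, ← Matrix.mulVec_transpose,
          Matrix.transpose_mul, Matrix.transpose_transpose, ← Matrix.mulVec_mulVec] at h3
      exact dotProduct_self_eq_zero.mp h2
    · right
      have h3 := congrArg (fun v => (C * Yᵀ) *ᵥ v) he
      have h4 : (C * Yᵀ) * (Y * Hᵀ * (Y * Hᵀ)ᵀ) = 0 := by
        have : (C * Yᵀ) * (Y * Hᵀ * (Y * Hᵀ)ᵀ) = C * (Yᵀ * Y) * Hᵀ * (Y * Hᵀ)ᵀ := by
          simp only [Matrix.mul_assoc]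
        rw [this, hCWH, Matrix.zero_mul]
      simp only [Matrix.mulVec_mulVec, h4, Matrix.zero_mulVec, Matrix.mulVec_smul] at h3
      rw [Matrix.mulVec_mulVec]
      exact (smul_eq_zero.mp h3.symm).resolve_left hl
  have htr : (Q * (Yᵀ * Y)).trace
      = ∑ i, (Yᵀ *ᵥ U.col i) ⬝ᵥ (Q *ᵥ (Yᵀ *ᵥ U.col i)) := by
    have h1 : (Q * (Yᵀ * Y)).trace = (Uᵀ * (Y * Q * Yᵀ) * U).trace := by
      rw [Matrix.mul_assoc Uᵀ, Matrix.trace_mul_comm Uᵀ, Matrix.mul_assoc _ U, hUU, Matrix.mul_one,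
        Matrix.mul_assoc Y, Matrix.trace_mul_comm Y, ← Matrix.mul_assoc Q]
    rw [h1, Matrix.trace]
    refine Finset.sum_congr rfl fun i _ => ?_
    have h2 : (Uᵀ * (Y * Q * Yᵀ) * U).diag i = U.col i ⬝ᵥ ((Y * Q * Yᵀ) *ᵥ U.col i) := by
      rw [Matrix.diag_apply, Matrix.mul_assoc]
      rfl
    rw [h2, ← Matrix.mulVec_mulVec, ← Matrix.mulVec_mulVec, Matrix.dotProduct_mulVec,
      ← Matrix.mulVec_transpose]
  have hterm : ∀ i, Yᵀ *ᵥ U.col i ≠ 0 →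
      (Yᵀ *ᵥ U.col i) ⬝ᵥ (Q *ᵥ (Yᵀ *ᵥ U.col i)) < 0 := fun i hi =>
    (hker i).elim (hH _ hi) (hC _ hi)
  rw [htr]
  refine Finset.sum_neg' (fun i _ => ?_) ?_
  · by_cases hi : Yᵀ *ᵥ U.col i = 0
    · simp [hi]
    · exact (hterm i hi).le
  · by_contra! hcon
    have h0 : ∀ i, Yᵀ *ᵥ U.col i = 0 := fun i => by
      by_contra hi
      exact absurd (hterm i hi) (not_lt.mpr (hcon i (Finset.mem_univ i)))
    have h1 : Yᵀ * U = 0 := by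
      ext a i
      exact congrFun (h0 i) a
    have h2 : Yᵀ = 0 := by
      rw [← Matrix.mul_one Yᵀ, ← hUU, ← Matrix.mul_assoc, h1, Matrix.zero_mul]
    exact hW0 (by rw [h2, Matrix.zero_mul])

/-- The positive semidefinite matrices of trace one. -/
def spectraplex (ι : Type*) [Fintype ι] : Set (Matrix ι ι ℝ) := {W | W.PosSemidef ∧ W.trace = 1}

theorem convex_spectraplex : Convex ℝ (spectraplex ι) := by
  rintro W ⟨hW, hW1⟩ W' ⟨hW', hW1'⟩ a b ha hb hab
  refine ⟨(hW.smul ha).add (hW'.smul hb), ?_⟩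
  simp [Matrix.trace_add, Matrix.trace_smul, hW1, hW1', hab]

theorem isCompact_spectraplex : IsCompact (spectraplex ι) := by
  classical
  have hbox : IsCompact (Set.univ.pi fun _ : ι => Set.univ.pi fun _ : ι => Set.Icc (-1 : ℝ) 1) :=
    isCompact_univ_pi fun _ => isCompact_univ_pi fun _ => isCompact_Icc
  refine IsCompact.of_isClosed_subset (s := (Set.univ.pi fun _ : ι => Set.univ.pi fun _ : ι =>
    Set.Icc (-1 : ℝ) 1 : Set (Matrix ι ι ℝ))) hbox ?_ ?_
  · have : spectraplex ι = {W | W.IsHermitian} ∩ (⋂ z : ι → ℝ, {W | 0 ≤ star z ⬝ᵥ (W *ᵥ z)})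
        ∩ {W | W.trace = 1} := by
      ext W
      simp [spectraplex, Matrix.posSemidef_iff_dotProduct_mulVec]
    rw [this]
    refine IsClosed.inter (IsClosed.inter ?_ (isClosed_iInter fun z => ?_)) ?_
    · exact isClosed_eq (Continuous.matrix_conjTranspose continuous_id) continuous_id
    · exact isClosed_le continuous_const
        (continuous_const.dotProduct (continuous_id.matrix_mulVec continuous_const))
    · exact isClosed_eq (Continuous.matrix_trace continuous_id) continuous_const
  · rintro (W : Matrix ι ι ℝ) ⟨hW, hW1⟩ i - j -
    have hd : ∀ k, 0 ≤ W k k := fun k => hW.diag_nonneg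
    have hle : ∀ k, W k k ≤ 1 := fun k => by
      rw [← hW1]
      exact Finset.single_le_sum (f := fun k => W k k) (fun k _ => hd k) (Finset.mem_univ k)
    have hsym : W j i = W i j := by simpa using hW.isHermitian.apply i j
    -- Testing `W` on `eᵢ ± eⱼ` bounds `|Wᵢⱼ|` by the mean of `Wᵢᵢ` and `Wⱼⱼ`, hence by one.
    have hq : ∀ s : ℝ, 0 ≤ W i i + s * W j i + s * (W i j + s * W j j) := fun s => by
      have := hW.dotProduct_mulVec_nonneg (Pi.single i 1 + s • Pi.single j 1)
      rw [Matrix.mulVec_add, Matrix.mulVec_smul] at this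
      simpa [add_dotProduct, smul_dotProduct] using this
    have h1 := hq 1
    have h2 := hq (-1)
    constructor <;> nlinarith [hle i, hle j]

theorem vecMulVec_self_mem_spectraplex {z : ι → ℝ} (hz : z ⬝ᵥ z = 1) :
    Matrix.vecMulVec z z ∈ spectraplex ι := by
  refine ⟨by simpa using Matrix.posSemidef_vecMulVec_self_star z, ?_⟩
  rw [Matrix.trace_vecMulVec, hz]

/-- Hahn-Banach separates the compact convex set of pairs `(tr(QW), CWHᵀ)`, with `W` in the
spectraplex, from `[0, ∞) × {0}`; the trace lemma makes them disjoint. The separating functional,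
scaled, is `V`, and the rank-one matrices `W = zzᵀ` yield the inequality. -/
theorem exists_forall_dotProduct_neg [Fintype μ] (Q : Matrix ι ι ℝ) (H : Matrix κ ι ℝ) (C : Matrix μ ι ℝ)
    (hH : ∀ z, z ≠ 0 → H *ᵥ z = 0 → z ⬝ᵥ (Q *ᵥ z) < 0)
    (hC : ∀ z, z ≠ 0 → C *ᵥ z = 0 → z ⬝ᵥ (Q *ᵥ z) < 0) :
    ∃ V : Matrix κ μ ℝ, ∀ z, z ≠ 0 →
      z ⬝ᵥ (Q *ᵥ z) + (H *ᵥ z) ⬝ᵥ (V *ᵥ (C *ᵥ z)) < 0 := by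
  classical
  let ψ : Matrix ι ι ℝ →ₗ[ℝ] ℝ × (μ × κ → ℝ) :=
    { toFun := fun W => ((Q * W).trace, fun k => (C * W * Hᵀ) k.1 k.2)
      map_add' := fun W W' => by
        ext <;> simp [Matrix.mul_add, Matrix.add_mul]
      map_smul' := fun a W => by
        ext <;> simp }
  have hψc : Continuous ψ := ψ.continuous_of_finiteDimensional
  have hK : IsCompact (ψ '' spectraplex ι) := isCompact_spectraplex.image hψc
  have hKc : Convex ℝ (ψ '' spectraplex ι) := convex_spectraplex.linear_image ψ
  let D : Set (ℝ × (μ × κ → ℝ)) := Set.Ici 0 ×ˢ {0}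
  have hdisj : Disjoint (ψ '' spectraplex ι) D := by
    rw [Set.disjoint_left]
    rintro _ ⟨W, ⟨hW, hW1⟩, rfl⟩ ⟨h1, h2⟩
    refine absurd (trace_mul_neg_of_posSemidef Q H C hH hC hW ?_ ?_) (not_lt.mpr h1)
    · rintro rfl
      simp at hW1
    · ext i j
      exact congrFun h2 (i, j)
  obtain ⟨f, u, v, hfK, huv, hfD⟩ := geometric_hahn_banach_compact_closed hKc hK
    ((convex_Ici 0).prod (convex_singleton 0)) (isClosed_Ici.prod isClosed_singleton) hdisj
  have hu : u < 0 := by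
    have := hfD 0 ⟨Set.self_mem_Ici, rfl⟩
    rw [map_zero] at this
    exact huv.trans this
  have hsplit : ∀ r M, f (r, M) = r * f (1, 0) + f (0, M) := fun r M => by
    have : ((r, M) : ℝ × (μ × κ → ℝ)) = r • (1, 0) + (0, M) := by simp
    rw [this, map_add, map_smul, smul_eq_mul]
  -- Otherwise the ray `(r, 0)`, `r ≥ 0`, would contain a point where `f` equals `v`.
  have hα : 0 ≤ f (1, 0) := by
    by_contra! hneg
    have h := hfD (v / f (1, 0), 0) ⟨?_, rfl⟩
    · have h0 : f (0, (0 : μ × κ → ℝ)) = 0 := f.map_zero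
      rw [hsplit, h0, add_zero, div_mul_cancel₀ _ hneg.ne] at h
      exact lt_irrefl _ h
    · by_cases hv : v ≤ 0
      · exact div_nonneg_of_nonpos hv hneg.le
      · have := hfD 0 ⟨Set.self_mem_Ici, rfl⟩
        rw [map_zero] at this
        exact absurd this.le hv
  obtain ⟨t, ht⟩ : ∃ t : ℝ, ∀ W ∈ spectraplex ι,
      (Q * W).trace + t * f (0, fun k => (C * W * Hᵀ) k.1 k.2) < 0 := by
    have hval : ∀ W ∈ spectraplex ι, (Q * W).trace * f (1, 0)
        + f (0, fun k => (C * W * Hᵀ) k.1 k.2) < u := fun W hW => by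
      rw [← hsplit]
      exact hfK _ ⟨W, hW, rfl⟩
    rcases hα.eq_or_lt with h0 | hpos
    -- If the functional ignores the trace, its second part is already below `u < 0` on the whole
    -- spectraplex. A large multiple then outweighs the trace, which is bounded above by
    -- compactness.
    · obtain ⟨b, hb⟩ := (isCompact_spectraplex.image
        (show Continuous fun W : Matrix ι ι ℝ => (Q * W).trace from
          continuous_fst.comp hψc)).bddAbove
      refine ⟨(|b| + 1) / (-u), fun W hW => ?_⟩
      have h1 := hval W hW
      rw [← h0, mul_zero, zero_add] at h1
      have h2 : (Q * W).trace ≤ b := hb ⟨W, hW, rfl⟩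
      have h3 : 0 < (|b| + 1) / (-u) := div_pos (by positivity) (neg_pos.mpr hu)
      have h4 := mul_lt_mul_of_pos_left h1 h3
      have h5 : (|b| + 1) / (-u) * u = -(|b| + 1) := by
        rw [div_neg, neg_mul, div_mul_cancel₀ _ hu.ne]
      linarith [le_abs_self b]
    · refine ⟨1 / f (1, 0), fun W hW => ?_⟩
      have h1 := mul_lt_mul_of_pos_left ((hval W hW).trans hu) (one_div_pos.mpr hpos)
      have h2 : 1 / f (1, 0) * ((Q * W).trace * f (1, 0)) = (Q * W).trace := by
        field_simp
      linarith [h1, h2]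
  let g : (μ × κ → ℝ) →ₗ[ℝ] ℝ := f.toLinearMap ∘ₗ LinearMap.inr ℝ ℝ (μ × κ → ℝ)
  have hg : ∀ M, f (0, M) = ∑ k, M k * g (fun j => if k = j then 1 else 0) := fun M =>
    g.pi_apply_eq_sum_univ M
  refine ⟨Matrix.of fun i j => t * g (fun l => if (j, i) = l then 1 else 0), fun z hz => ?_⟩
  have hzz : 0 < z ⬝ᵥ z := by
    have := Matrix.dotProduct_star_self_pos_iff.mpr hz
    simpa using this
  -- Scaling `z` to unit length gives `zzᵀ` trace one; the factor `s * s` is cancelled at the end.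
  set s : ℝ := (√(z ⬝ᵥ z))⁻¹ with hs
  have hs2 : s * s * (z ⬝ᵥ z) = 1 := by
    rw [hs, ← mul_inv, Real.mul_self_sqrt hzz.le, inv_mul_cancel₀ hzz.ne']
  have hmem := ht _ (vecMulVec_self_mem_spectraplex (z := s • z)
    (by simpa [mul_assoc] using hs2))
  have h1 : (Q * Matrix.vecMulVec (s • z) (s • z)).trace = s * s * (z ⬝ᵥ (Q *ᵥ z)) := by
    rw [Matrix.mul_vecMulVec, Matrix.trace_vecMulVec, Matrix.mulVec_smul, smul_dotProduct,
      dotProduct_smul, smul_eq_mul, smul_eq_mul, dotProduct_comm, mul_assoc]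
  have h2 : ∀ k : μ × κ, (C * Matrix.vecMulVec (s • z) (s • z) * Hᵀ) k.1 k.2
      = s * s * ((C *ᵥ z) k.1 * (H *ᵥ z) k.2) := fun k => by
    rw [Matrix.mul_vecMulVec, Matrix.vecMulVec_mul, Matrix.vecMulVec_apply, Matrix.vecMul_transpose,
      Matrix.mulVec_smul, Matrix.mulVec_smul, Pi.smul_apply, Pi.smul_apply, smul_eq_mul,
      smul_eq_mul]
    ring
  rw [h1, hg] at hmem
  simp only [h2] at hmem
  have h3 : (H *ᵥ z) ⬝ᵥ ((Matrix.of fun i j => t * g (fun l => if (j, i) = l then 1 else 0))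
      *ᵥ (C *ᵥ z)) = t * ∑ k : μ × κ, ((C *ᵥ z) k.1 * (H *ᵥ z) k.2) *
        g (fun j => if k = j then 1 else 0) := by
    rw [Fintype.sum_prod_type_right, Finset.mul_sum, dotProduct]
    refine Finset.sum_congr rfl fun i _ => ?_
    rw [show ((Matrix.of fun i j => t * g (fun l => if (j, i) = l then 1 else 0)) *ᵥ (C *ᵥ z)) i
      = ∑ j, t * g (fun l => if (j, i) = l then 1 else 0) * (C *ᵥ z) j from rfl, Finset.mul_sum, Finset.mul_sum]
    refine Finset.sum_congr rfl fun j _ => ?_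
    ring
  rw [h3]
  have h4 : s * s * (z ⬝ᵥ (Q *ᵥ z) + t * ∑ k : μ × κ, ((C *ᵥ z) k.1 * (H *ᵥ z) k.2) *
        g (fun j => if k = j then 1 else 0)) < 0 := by
    refine lt_of_eq_of_lt ?_ hmem
    rw [mul_add, mul_left_comm, Finset.mul_sum]
    congr 2
    exact Finset.sum_congr rfl fun k _ => by ring
  have hs0 : 0 < s * s := by
    have : 0 < s := inv_pos.mpr (Real.sqrt_pos.mpr hzz)
    positivity
  exact (pos_iff_neg_of_mul_neg h4).mp hs0

end Elimination

/-! ### Quadratic forms -/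

theorem negDef_iff {ι : Type*} [Fintype ι] {M : Matrix ι ι ℝ} :
    NegDef M ↔ M.IsSymm ∧ ∀ z, z ≠ 0 → z ⬝ᵥ (M *ᵥ z) < 0 := by
  simp only [NegDef, Matrix.posDef_iff_dotProduct_mulVec, Matrix.IsHermitian, Matrix.IsSymm,
    Matrix.conjTranspose_eq_transpose_of_trivial, Matrix.transpose_neg, neg_inj, star_trivial,
    Matrix.neg_mulVec, dotProduct_neg, Left.neg_pos_iff]

theorem dotProduct_mul_mul_mulVec {ι κ : Type*} [Fintype ι] [Fintype κ] (S : Matrix κ ι ℝ)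
    (P : Matrix κ κ ℝ) (z : ι → ℝ) :
    z ⬝ᵥ ((Sᵀ * P * S) *ᵥ z) = (S *ᵥ z) ⬝ᵥ (P *ᵥ (S *ᵥ z)) := by
  rw [← Matrix.mulVec_mulVec, ← Matrix.mulVec_mulVec, Matrix.dotProduct_mulVec,
    Matrix.vecMul_transpose]

theorem dotProduct_He_mulVec {ι : Type*} [Fintype ι] (M : Matrix ι ι ℝ) (z : ι → ℝ) :
    z ⬝ᵥ (He M *ᵥ z) = 2 * (z ⬝ᵥ (M *ᵥ z)) := by
  rw [He, Matrix.add_mulVec, dotProduct_add, Matrix.mulVec_transpose, dotProduct_comm z,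
    ← Matrix.dotProduct_mulVec, two_mul]

theorem isSymm_He {ι : Type*} (M : Matrix ι ι ℝ) : (He M).IsSymm := by
  simp [He, Matrix.IsSymm, add_comm]

theorem mem_lyapSet_iff {n : ℕ} {S P : Matrix (Fin n) (Fin n) ℝ} :
    P ∈ lyapSet S ↔ P.PosDef ∧
      ∀ x, x ≠ 0 → (S *ᵥ x) ⬝ᵥ (P *ᵥ (S *ᵥ x)) - x ⬝ᵥ (P *ᵥ x) < 0 := by
  refine and_congr_right fun hP => ?_
  have hsymm : Pᵀ = P := by simpa using hP.isHermitian.eq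
  rw [negDef_iff]
  simp only [Matrix.sub_mulVec, dotProduct_sub, dotProduct_mul_mul_mulVec]
  refine and_iff_right ?_
  simp [Matrix.IsSymm, hsymm, Matrix.mul_assoc]

/-! ### The Lyapunov inequality bounds the spectral radius -/

/-- For a complex eigenvector `v = a + ib`, the real forms at `a` and `b` add up to `v*Pv`, which
`S` multiplies by `|k|²`. The Lyapunov decrease is strict because `a` or `b` is nonzero. -/
theorem norm_lt_one_of_mem_lyapSet {n : ℕ} {S P : Matrix (Fin n) (Fin n) ℝ} (hP : P ∈ lyapSet S)
    {k : ℂ} (hk : k ∈ spectrum ℂ (S.map (algebraMap ℝ ℂ))) : ‖k‖ < 1 := by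
  rw [mem_lyapSet_iff] at hP
  obtain ⟨hPD, hL⟩ := hP
  have hsymm : Pᵀ = P := by simpa using hPD.isHermitian.eq
  rw [← Matrix.spectrum_toLin', ← Module.End.hasEigenvalue_iff_mem_spectrum] at hk
  obtain ⟨v, hv⟩ := hk.exists_hasEigenvector
  have hSv : (S.map (algebraMap ℝ ℂ)) *ᵥ v = k • v := by
    simpa [Matrix.toLin'_apply] using hv.apply_eq_smul
  set a : Fin n → ℝ := fun i => (v i).re
  set b : Fin n → ℝ := fun i => (v i).im
  have hSa : S *ᵥ a = k.re • a - k.im • b := by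
    ext i
    have := congrArg Complex.re (congrFun hSv i)
    simpa [Matrix.mulVec, dotProduct, a, b, Complex.re_sum] using this
  have hSb : S *ᵥ b = k.im • a + k.re • b := by
    ext i
    have := congrArg Complex.im (congrFun hSv i)
    simpa [Matrix.mulVec, dotProduct, a, b, Complex.im_sum, add_comm] using this
  have hab : a ≠ 0 ∨ b ≠ 0 := by
    by_contra! h
    refine hv.2 (funext fun i => Complex.ext ?_ ?_)
    · exact congrFun h.1 i
    · exact congrFun h.2 i
  have hnn : ∀ x : Fin n → ℝ, 0 ≤ x ⬝ᵥ (P *ᵥ x) := fun x => by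
    simpa using hPD.posSemidef.dotProduct_mulVec_nonneg x
  have hle : ∀ x : Fin n → ℝ, (S *ᵥ x) ⬝ᵥ (P *ᵥ (S *ᵥ x)) - x ⬝ᵥ (P *ᵥ x) ≤ 0 := fun x => by
    by_cases hx : x = 0
    · simp [hx]
    · exact (hL x hx).le
  have hba : b ⬝ᵥ (P *ᵥ a) = a ⬝ᵥ (P *ᵥ b) := by
    rw [Matrix.dotProduct_mulVec, ← Matrix.mulVec_transpose, hsymm, dotProduct_comm]
  have key : (S *ᵥ a) ⬝ᵥ (P *ᵥ (S *ᵥ a)) + (S *ᵥ b) ⬝ᵥ (P *ᵥ (S *ᵥ b))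
      = (k.re ^ 2 + k.im ^ 2) * (a ⬝ᵥ (P *ᵥ a) + b ⬝ᵥ (P *ᵥ b)) := by
    rw [hSa, hSb]
    simp only [Matrix.mulVec_add, Matrix.mulVec_sub, Matrix.mulVec_smul, add_dotProduct,
      sub_dotProduct, dotProduct_add, dotProduct_sub, smul_dotProduct, dotProduct_smul,
      smul_eq_mul, hba]
    ring
  have hneg : (k.re ^ 2 + k.im ^ 2) * (a ⬝ᵥ (P *ᵥ a) + b ⬝ᵥ (P *ᵥ b))
      < a ⬝ᵥ (P *ᵥ a) + b ⬝ᵥ (P *ᵥ b) := by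
    rw [← key]
    rcases hab with h | h
    · linarith [hL _ h, hle b]
    · linarith [hL _ h, hle a]
  have hsq : k.re ^ 2 + k.im ^ 2 < 1 := by
    by_contra! h
    nlinarith [hnn a, hnn b]
  have hnorm : ‖k‖ ^ 2 < 1 := by
    rw [Complex.sq_norm, Complex.normSq_apply]
    linarith [sq k.re, sq k.im]
  exact (sq_lt_one_iff₀ (norm_nonneg k)).mp hnorm

theorem spectralRadius_lt_one_of_mem_lyapSet {n : ℕ} {S P : Matrix (Fin n) (Fin n) ℝ}
    (hP : P ∈ lyapSet S) : spectralRadius ℂ (S.map (algebraMap ℝ ℂ)) < 1 := by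
  let _ : NormedRing (Matrix (Fin n) (Fin n) ℂ) := Matrix.linftyOpNormedRing
  let _ : NormedAlgebra ℂ (Matrix (Fin n) (Fin n) ℂ) := Matrix.linftyOpNormedAlgebra
  -- For `n = 0` the spectrum is empty, so the bound on eigenvalues is of no use there.
  rcases isEmpty_or_nonempty (Fin n) with hn | hn
  · rw [spectrum.SpectralRadius.of_subsingleton]
    exact one_pos
  · have : CompleteSpace (Matrix (Fin n) (Fin n) ℂ) := FiniteDimensional.complete ℂ _
    exact spectrum.spectralRadius_lt_of_forall_lt (r := 1) _ fun k hk =>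
      norm_lt_one_of_mem_lyapSet hP hk

/-! ### Block lower triangular gains and closed-loop trajectories -/

/-- An `N × N` block matrix with blocks of size `a × b` that is block lower triangular. -/
def IsBlockLower {N a b : ℕ} (F : Matrix (Fin N × Fin a) (Fin N × Fin b) ℝ) : Prop :=
  ∀ i j : Fin N, i < j → ∀ (r : Fin a) (c : Fin b), F (i, r) (j, c) = 0

theorem isBlockLower_gainDown {N m p : ℕ} (F : Fin N → Fin N → Matrix (Fin m) (Fin p) ℝ) :
    IsBlockLower (gainDown F) := fun i j hij r c => by
  simp [gainDown, hij]

/-- The block in block row `i` and block column `j`. -/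
def blockAt {N a b : ℕ} (F : Matrix (Fin N × Fin a) (Fin N × Fin b) ℝ) (i j : Fin N) :
    Matrix (Fin a) (Fin b) ℝ := Matrix.of fun r c => F (i, r) (j, c)

theorem kronecker_mulVec_apply {k l a b : ℕ} (M : Matrix (Fin k) (Fin l) ℝ)
    (A : Matrix (Fin a) (Fin b) ℝ) (x : Fin l × Fin b → ℝ) (i : Fin k) (r : Fin a) :
    ((M ⊗ₖ A) *ᵥ x) (i, r) = ∑ j, M i j * (A *ᵥ fun s => x (j, s)) r := by
  simp only [Matrix.mulVec, dotProduct, Fintype.sum_prod_type, Finset.mul_sum,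
    Matrix.kroneckerMap_apply, mul_assoc]

theorem one_kronecker_mulVec_apply {k a b : ℕ} (A : Matrix (Fin a) (Fin b) ℝ)
    (x : Fin k × Fin b → ℝ) (i : Fin k) (r : Fin a) :
    (((1 : Matrix (Fin k) (Fin k) ℝ) ⊗ₖ A) *ᵥ x) (i, r) = (A *ᵥ fun s => x (i, s)) r := by
  simp [kronecker_mulVec_apply, Matrix.one_apply]

section Trajectory

variable {N n m p : ℕ} (A : Matrix (Fin n) (Fin n) ℝ) (B : Matrix (Fin n) (Fin m) ℝ)
  (C : Matrix (Fin p) (Fin n) ℝ) {F : Matrix (Fin N × Fin m) (Fin N × Fin p) ℝ}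

theorem augMatrix_apply (F : Matrix (Fin N × Fin m) (Fin N × Fin p) ℝ) (δ : ℕ) (h : δ ≤ N)
    (i j : Fin δ) (r s : Fin n) :
    augMatrix A B C F δ h (i, r) (j, s)
      = (if i = j then A r s else 0)
        + (B * blockAt F (Fin.castLE h i) (Fin.castLE h j) * C) r s := by
  simp [augMatrix, truncGain, blockAt, Matrix.mul_apply, Fintype.sum_prod_type,
    Matrix.one_apply, Finset.sum_mul]

theorem augMatrix_apply_of_lt (hF : IsBlockLower F) {i j : Fin N} (hij : i < j) (r s : Fin n) :
    augMatrix A B C F N le_rfl (i, r) (j, s) = 0 := by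
  have h0 : blockAt F (Fin.castLE le_rfl i) (Fin.castLE le_rfl j) = 0 := by
    ext a b
    exact hF i j hij a b
  rw [augMatrix_apply, h0, if_neg hij.ne]
  simp

theorem augMatrix_mulVec (F : Matrix (Fin N × Fin m) (Fin N × Fin p) ℝ)
    (x : Fin N × Fin n → ℝ) :
    augMatrix A B C F N le_rfl *ᵥ x = ((1 : Matrix (Fin N) (Fin N) ℝ) ⊗ₖ A) *ᵥ x
      + ((1 : Matrix (Fin N) (Fin N) ℝ) ⊗ₖ B) *ᵥ
        ((F * ((1 : Matrix (Fin N) (Fin N) ℝ) ⊗ₖ C)) *ᵥ x) := by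
  have : truncGain F N le_rfl = F := rfl
  rw [augMatrix, this, Matrix.add_mulVec, Matrix.mulVec_mulVec, Matrix.mul_assoc]

/-- Later recursion steps only append blocks, so a block does not depend on the length of the stack.
-/
theorem stackLTI_apply_eq (F : Matrix (Fin N × Fin m) (Fin N × Fin p) ℝ) :
    ∀ (δ : ℕ) (h : δ ≤ N) (i : Fin (δ + 1)) (r c : Fin n),
      stackLTI A B C F δ h (i, r) c
        = stackLTI A B C F i ((Nat.le_of_lt_succ i.isLt).trans h) (Fin.last i, r) c
  | 0, h, i, r, c => by
    obtain rfl : i = 0 := Fin.fin_one_eq_zero i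
    rfl
  | δ + 1, h, i, r, c => by
    induction i using Fin.lastCases with
    | last => rfl
    | cast i =>
      have h1 : stackLTI A B C F (δ + 1) h (i.castSucc, r) c
          = stackLTI A B C F δ (Nat.le_of_succ_le h) (i, r) c := by
        simp [stackLTI]
      rw [h1, stackLTI_apply_eq F δ _ i r c]
      rfl

/-- The first `N` block rows of `stackLTI`, which give the states `x(Nt), …, x(Nt + N - 1)`. -/
def stateStack (F : Matrix (Fin N × Fin m) (Fin N × Fin p) ℝ) :
    Matrix (Fin N × Fin n) (Fin n) ℝ :=
  (stackLTI A B C F N le_rfl).submatrix (fun r => (r.1.castSucc, r.2)) id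

theorem stackLTI_zero (F : Matrix (Fin N × Fin m) (Fin N × Fin p) ℝ) (r c : Fin n) :
    stackLTI A B C F N le_rfl (0, r) c = (1 : Matrix (Fin n) (Fin n) ℝ) r c := by
  rw [stackLTI_apply_eq]
  rfl

/-- The recursion uses the truncated augmented matrix. By block lower triangularity the full matrix
has the same row followed by zeros, so all steps become rows of one equation. -/
theorem stackLTI_succ (hF : IsBlockLower F) (i : Fin N) (r c : Fin n) :
    stackLTI A B C F N le_rfl (i.succ, r) c
      = (augMatrix A B C F N le_rfl * stateStack A B C F) (i, r) c := by
  obtain ⟨k, hk⟩ := i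
  rw [stackLTI_apply_eq]
  have h1 : stackLTI A B C F (k + 1) hk (Fin.last (k + 1), r) c
      = (augMatrix A B C F (k + 1) hk * stackLTI A B C F k (Nat.le_of_succ_le hk))
          (Fin.last k, r) c := by
    simp [stackLTI]
  refine h1.trans ?_
  rw [Matrix.mul_apply, Matrix.mul_apply]
  refine Fintype.sum_of_injective (fun a : Fin (k + 1) × Fin n => (Fin.castLE hk a.1, a.2)) ?_ _ _
    ?_ ?_
  · rintro ⟨a, s⟩ ⟨b, t⟩ hab
    simpa using hab
  · rintro ⟨j, s⟩ hj
    have hlt : (⟨k, hk⟩ : Fin N) < j := by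
      by_contra hcon
      exact hj ⟨(⟨j, Nat.lt_succ_of_le (not_lt.mp hcon)⟩, s), rfl⟩
    rw [augMatrix_apply_of_lt A B C hF hlt, zero_mul]
  · rintro ⟨j, s⟩
    congr 1
    · rw [augMatrix_apply, augMatrix_apply]
      congr 1
      refine if_congr ?_ rfl rfl
      simp [Fin.ext_iff]
    · exact (stackLTI_apply_eq A B C F k _ j s c).trans
        (stackLTI_apply_eq A B C F N le_rfl (Fin.castLE hk j).castSucc s c).symm

theorem stackLTI_succ_mulVec (hF : IsBlockLower F) (i : Fin N) (r : Fin n) (x₀ : Fin n → ℝ) :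
    (stackLTI A B C F N le_rfl *ᵥ x₀) (i.succ, r)
      = (augMatrix A B C F N le_rfl *ᵥ (stateStack A B C F *ᵥ x₀)) (i, r) := by
  rw [Matrix.mulVec_mulVec]
  simp only [Matrix.mulVec, dotProduct, stackLTI_succ A B C hF]

theorem stackLTI_zero_mulVec (F : Matrix (Fin N × Fin m) (Fin N × Fin p) ℝ) (r : Fin n)
    (x₀ : Fin n → ℝ) : (stackLTI A B C F N le_rfl *ᵥ x₀) (0, r) = x₀ r := by
  have : (stackLTI A B C F N le_rfl *ᵥ x₀) (0, r) = ((1 : Matrix (Fin n) (Fin n) ℝ) *ᵥ x₀) r := by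
    simp only [Matrix.mulVec, dotProduct, stackLTI_zero]
  rw [this, Matrix.one_mulVec]

end Trajectory

/-! ### The kernel of the constraint matrix -/

section Kernel

variable {K n m p : ℕ} (A : Matrix (Fin n) (Fin n) ℝ) (B : Matrix (Fin n) (Fin m) ℝ)
  (C : Matrix (Fin p) (Fin n) ℝ) {F : Matrix (Fin (K + 1) × Fin m) (Fin (K + 1) × Fin p) ℝ}

theorem leftSel_kronecker_mulVec_apply {a b : ℕ} (M : Matrix (Fin a) (Fin b) ℝ)
    (x : Fin (K + 1) × Fin b → ℝ) (i : Fin K) (r : Fin a) :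
    ((leftSel K (K + 1) ⊗ₖ M) *ᵥ x) (i, r) = (M *ᵥ fun s => x (i.castSucc, s)) r := by
  rw [kronecker_mulVec_apply, Finset.sum_eq_single i.castSucc]
  · simp [leftSel]
  · intro j _ hj
    have : (j : ℕ) ≠ i := fun h => hj (Fin.ext h)
    simp [leftSel, this]
  · simp

theorem rightSel_kronecker_mulVec_apply {a b : ℕ} (M : Matrix (Fin a) (Fin b) ℝ)
    (x : Fin (K + 1) × Fin b → ℝ) (i : Fin K) (r : Fin a) :
    ((rightSel K (K + 1) ⊗ₖ M) *ᵥ x) (i, r) = (M *ᵥ fun s => x (i.succ, s)) r := by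
  rw [kronecker_mulVec_apply, Finset.sum_eq_single i.succ]
  · simp [rightSel]
  · intro j _ hj
    have : (j : ℕ) ≠ i + 1 := fun h => hj (Fin.ext h)
    simp [rightSel, this]
  · simp

/-- The states and inputs of the closed-loop trajectory starting at `x₀`. -/
def closedLoop (F : Matrix (Fin (K + 1) × Fin m) (Fin (K + 1) × Fin p) ℝ) (x₀ : Fin n → ℝ) :
    (Fin (K + 1) × Fin n) ⊕ (Fin (K + 1) × Fin m) → ℝ :=
  Sum.elim (stateStack A B C F *ᵥ x₀)
    ((F * ((1 : Matrix (Fin (K + 1)) (Fin (K + 1)) ℝ) ⊗ₖ C)) *ᵥ (stateStack A B C F *ᵥ x₀))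

/-- The upper block row is the feedback law and the lower one the state recursion, into which the
law is substituted. -/
theorem cMat_mulVec_eq_zero_iff (F : Matrix (Fin (K + 1) × Fin m) (Fin (K + 1) × Fin p) ℝ)
    (x : Fin (K + 1) × Fin n → ℝ) (u : Fin (K + 1) × Fin m → ℝ) :
    cMat A B C F *ᵥ Sum.elim x u = 0 ↔
      u = (F * ((1 : Matrix (Fin (K + 1)) (Fin (K + 1)) ℝ) ⊗ₖ C)) *ᵥ x ∧
      ∀ (i : Fin K) (r : Fin n),
        x (i.succ, r) = (augMatrix A B C F (K + 1) le_rfl *ᵥ x) (i.castSucc, r) := by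
  have hsplit : cMat A B C F *ᵥ Sum.elim x u = 0 ↔
      (F * ((1 : Matrix (Fin (K + 1)) (Fin (K + 1)) ℝ) ⊗ₖ C)) *ᵥ x - u = 0 ∧
      (leftSel K (K + 1) ⊗ₖ A) *ᵥ x - (rightSel K (K + 1) ⊗ₖ (1 : Matrix (Fin n) (Fin n) ℝ)) *ᵥ x
        + (leftSel K (K + 1) ⊗ₖ B) *ᵥ u = 0 := by
    rw [cMat, Matrix.fromBlocks_mulVec, Matrix.one_kronecker_one, Matrix.neg_mulVec,
      Matrix.one_mulVec, ← sub_eq_add_neg, Matrix.sub_mulVec]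
    refine ⟨fun h => ⟨funext fun a => congrFun h (Sum.inl a), funext fun a => congrFun h (Sum.inr a)⟩,
      fun h => funext fun a => ?_⟩
    rcases a with a | a
    · exact congrFun h.1 a
    · exact congrFun h.2 a
  rw [hsplit, sub_eq_zero, eq_comm (b := u)]
  refine and_congr_right fun hu => ?_
  have hrow : ∀ (i : Fin K) (r : Fin n),
      ((leftSel K (K + 1) ⊗ₖ A) *ᵥ x - (rightSel K (K + 1) ⊗ₖ (1 : Matrix (Fin n) (Fin n) ℝ)) *ᵥ x
        + (leftSel K (K + 1) ⊗ₖ B) *ᵥ u) (i, r)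
      = (augMatrix A B C F (K + 1) le_rfl *ᵥ x) (i.castSucc, r) - x (i.succ, r) := by
    intro i r
    rw [augMatrix_mulVec, ← hu]
    simp only [Pi.add_apply, Pi.sub_apply, leftSel_kronecker_mulVec_apply,
      rightSel_kronecker_mulVec_apply, one_kronecker_mulVec_apply, Matrix.one_mulVec]
    ring
  constructor
  · intro h i r
    have := hrow i r
    rw [h] at this
    exact (sub_eq_zero.mp this.symm).symm
  · intro h
    ext ⟨i, r⟩
    rw [hrow, ← h, sub_self]
    rfl

theorem stateStack_zero_mulVec (x₀ : Fin n → ℝ) (r : Fin n) :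
    (stateStack A B C F *ᵥ x₀) (0, r) = x₀ r :=
  stackLTI_zero_mulVec A B C F r x₀

theorem cMat_mulVec_closedLoop (hF : IsBlockLower F) (x₀ : Fin n → ℝ) :
    cMat A B C F *ᵥ closedLoop A B C F x₀ = 0 :=
  (cMat_mulVec_eq_zero_iff A B C F _ _).mpr
    ⟨rfl, fun i r => stackLTI_succ_mulVec A B C hF i.castSucc r x₀⟩

/-- By causality, a kernel vector is determined by its initial state: strong induction on time shows
that its states are those of the closed loop. -/
theorem exists_eq_closedLoop (hF : IsBlockLower F)
    {z : (Fin (K + 1) × Fin n) ⊕ (Fin (K + 1) × Fin m) → ℝ} (hz : cMat A B C F *ᵥ z = 0) :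
    ∃ x₀, z = closedLoop A B C F x₀ := by
  obtain ⟨x, u, rfl⟩ : ∃ x u, z = Sum.elim x u :=
    ⟨z ∘ Sum.inl, z ∘ Sum.inr, (Sum.elim_comp_inl_inr z).symm⟩
  rw [cMat_mulVec_eq_zero_iff] at hz
  obtain ⟨rfl, hx⟩ := hz
  refine ⟨fun r => x (0, r), ?_⟩
  set x₀ : Fin n → ℝ := fun r => x (0, r) with hx₀
  have hagree : ∀ (k : ℕ) (hk : k < K + 1) (r : Fin n),
      x (⟨k, hk⟩, r) = (stateStack A B C F *ᵥ x₀) (⟨k, hk⟩, r) := by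
    intro k
    induction k using Nat.strong_induction_on with
    | _ k ih =>
      intro hk r
      rcases k with _ | k
      · exact (stateStack_zero_mulVec A B C x₀ r).symm
      · have hk' : k < K := Nat.lt_of_succ_lt_succ hk
        refine (hx ⟨k, hk'⟩ r).trans (Eq.trans ?_
          (stackLTI_succ_mulVec A B C hF (Fin.castSucc ⟨k, hk'⟩) r x₀).symm)
        refine Finset.sum_congr rfl fun a _ => ?_
        obtain ⟨j, s⟩ := a
        -- Future states have coefficient zero; present and past ones agree by induction.
        rcases lt_or_ge (Fin.castSucc ⟨k, hk'⟩) j with hlt | hge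
        · simp only [augMatrix_apply_of_lt A B C hF hlt, zero_mul]
        · exact congrArg _ (ih j (Nat.lt_succ_of_le hge) j.isLt s)
  have hxx : x = stateStack A B C F *ᵥ x₀ := by
    ext ⟨⟨k, hk⟩, r⟩
    exact hagree k hk r
  rw [closedLoop, ← hxx]

theorem closedLoop_ne_zero {x₀ : Fin n → ℝ} (hx₀ : x₀ ≠ 0) : closedLoop A B C F x₀ ≠ 0 := by
  refine fun h => hx₀ (funext fun r => ?_)
  rw [← stateStack_zero_mulVec A B C (F := F) x₀ r]
  exact congrFun h (Sum.inl (0, r))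

theorem piMat_mulVec_closedLoop (hF : IsBlockLower F) (x₀ : Fin n → ℝ) :
    piMat (K + 1) A B *ᵥ closedLoop A B C F x₀ = stackLTI A B C F (K + 1) le_rfl *ᵥ x₀ := by
  ext ⟨i, r⟩
  induction i using Fin.cases with
  | zero =>
    have h : (piMat (K + 1) A B *ᵥ closedLoop A B C F x₀) (0, r)
        = (Matrix.fromCols
        (Matrix.replicateRow Unit (unitVec (K + 1) 1) ⊗ₖ (1 : Matrix (Fin n) (Fin n) ℝ))
        (0 : Matrix (Unit × Fin n) (Fin (K + 1) × Fin m) ℝ) *ᵥ closedLoop A B C F x₀) ((), r) :=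
      rfl
    rw [h, closedLoop, Matrix.fromCols_mulVec_sumElim, Matrix.zero_mulVec, add_zero,
      stackLTI_zero_mulVec, ← stateStack_zero_mulVec A B C (F := F) x₀ r, Matrix.mulVec,
      dotProduct, Fintype.sum_prod_type, Finset.sum_eq_single 0]
    · simp [unitVec, Matrix.one_apply]
    · intro j _ hj
      have hj0 : unitVec (K + 1) 1 j = 0 :=
        if_neg fun h => hj (Fin.ext (Nat.succ_injective h))
      refine Finset.sum_eq_zero fun s _ => ?_
      rw [Matrix.kroneckerMap_apply, Matrix.replicateRow_apply, hj0, zero_mul, zero_mul]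
    · simp
  | succ i =>
    have h : (piMat (K + 1) A B *ᵥ closedLoop A B C F x₀) (i.succ, r)
        = (Matrix.fromCols ((1 : Matrix (Fin (K + 1)) (Fin (K + 1)) ℝ) ⊗ₖ A)
          ((1 : Matrix (Fin (K + 1)) (Fin (K + 1)) ℝ) ⊗ₖ B) *ᵥ closedLoop A B C F x₀) (i, r) :=
      rfl
    rw [h, closedLoop, Matrix.fromCols_mulVec_sumElim, stackLTI_succ_mulVec A B C hF,
      augMatrix_mulVec]

theorem dotProduct_xMat_mulVec {N : ℕ} (P : Matrix (Fin n) (Fin n) ℝ)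
    (ξ : Fin (N + 1) × Fin n → ℝ) :
    ξ ⬝ᵥ (xMat N N P 1 *ᵥ ξ) =
      (fun r => ξ (Fin.last N, r)) ⬝ᵥ (P *ᵥ fun r => ξ (Fin.last N, r))
        - (fun r => ξ (0, r)) ⬝ᵥ (P *ᵥ fun r => ξ (0, r)) := by
  have h0 : unitVec (N + 1) 1 = Pi.single 0 1 := by
    ext j
    rw [unitVec, Pi.single_apply]
    exact if_congr (by rw [Fin.ext_iff, Fin.val_zero]; omega) rfl rfl
  have h1 : unitVec (N + 1) (N + 1) = Pi.single (Fin.last N) 1 := by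
    ext j
    rw [unitVec, Pi.single_apply]
    exact if_congr (by rw [Fin.ext_iff, Fin.val_last]; omega) rfl rfl
  have hrow : ∀ i r, (xMat N N P 1 *ᵥ ξ) (i, r)
      = (if i = Fin.last N then (P *ᵥ fun r => ξ (Fin.last N, r)) r else 0)
        - (if i = 0 then (P *ᵥ fun r => ξ (0, r)) r else 0) := fun i r => by
    rw [xMat, kronecker_mulVec_apply, h0, h1]
    have hsum : ∀ k : Fin (N + 1), ∑ j, (Pi.single k (1 : ℝ) : Fin (N + 1) → ℝ) i
        * (Pi.single k (1 : ℝ) : Fin (N + 1) → ℝ) j * (P *ᵥ fun s => ξ (j, s)) r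
        = if i = k then (P *ᵥ fun s => ξ (k, s)) r else 0 := fun k => by
      rw [Finset.sum_eq_single k]
      · by_cases h : i = k <;> simp [h]
      · intro j _ hj
        simp [hj]
      · simp
    rw [← hsum, ← hsum, ← Finset.sum_sub_distrib]
    refine Finset.sum_congr rfl fun j _ => ?_
    rw [Matrix.add_apply, Matrix.neg_apply, one_smul, Matrix.vecMulVec_apply,
      Matrix.vecMulVec_apply]
    ring
  rw [dotProduct, Fintype.sum_prod_type_right]
  simp only [hrow, mul_sub, mul_ite, mul_zero, Finset.sum_sub_distrib, Finset.sum_ite_eq',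
    Finset.mem_univ, if_true, dotProduct]

/-- `Π` sends the trajectory to the stack of states over the period, and `𝒳(P)` compares only its
last and first blocks. -/
theorem dotProduct_closedLoop (hF : IsBlockLower F) (P : Matrix (Fin n) (Fin n) ℝ)
    (x₀ : Fin n → ℝ) :
    closedLoop A B C F x₀ ⬝ᵥ (((piMat (K + 1) A B)ᵀ * xMat (K + 1) (K + 1) P 1 * piMat (K + 1) A B)
        *ᵥ closedLoop A B C F x₀)
      = (aLTI A B C F *ᵥ x₀) ⬝ᵥ (P *ᵥ (aLTI A B C F *ᵥ x₀)) - x₀ ⬝ᵥ (P *ᵥ x₀) := by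
  have h0 : (fun r => (stackLTI A B C F (K + 1) le_rfl *ᵥ x₀) (0, r)) = x₀ :=
    funext fun r => stackLTI_zero_mulVec A B C F r x₀
  rw [dotProduct_mul_mul_mulVec, piMat_mulVec_closedLoop A B C hF, dotProduct_xMat_mulVec, h0]
  rfl

theorem mem_lyapSet_aLTI_iff (hF : IsBlockLower F) {P : Matrix (Fin n) (Fin n) ℝ}
    (hP : P.PosDef) :
    P ∈ lyapSet (aLTI A B C F) ↔ ∀ z, z ≠ 0 → cMat A B C F *ᵥ z = 0 →
      z ⬝ᵥ (((piMat (K + 1) A B)ᵀ * xMat (K + 1) (K + 1) P 1 * piMat (K + 1) A B) *ᵥ z) < 0 := by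
  rw [mem_lyapSet_iff, and_iff_right hP]
  constructor
  · intro h z hz hCz
    obtain ⟨x₀, rfl⟩ := exists_eq_closedLoop A B C hF hCz
    rw [dotProduct_closedLoop A B C hF]
    refine h x₀ ?_
    rintro rfl
    refine hz ?_
    simp only [closedLoop, Matrix.mulVec_zero]
    exact Sum.elim_zero_zero
  · intro h x₀ hx₀
    rw [← dotProduct_closedLoop A B C hF]
    exact h _ (closedLoop_ne_zero A B C hx₀) (cMat_mulVec_closedLoop A B C hF x₀)

theorem hMat_eq_cMat (F : Matrix (Fin (K + 1) × Fin m) (Fin (K + 1) × Fin n) ℝ) :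
    hMat A B F = cMat A B (1 : Matrix (Fin n) (Fin n) ℝ) F := by
  rw [hMat, cMat, Matrix.one_kronecker_one, Matrix.one_kronecker_one, Matrix.mul_one]

theorem exists_BMI_iff {P : Matrix (Fin n) (Fin n) ℝ} (hP : P.PosDef) (hF : IsBlockLower F)
    {F' : Matrix (Fin (K + 1) × Fin m) (Fin (K + 1) × Fin n) ℝ} (hF' : IsBlockLower F') :
    (∃ V : Matrix ((Fin (K + 1) × Fin m) ⊕ (Fin (K + 1 - 1) × Fin n))
        ((Fin (K + 1) × Fin m) ⊕ (Fin (K + 1 - 1) × Fin n)) ℝ, BMI A B C P ((hMat A B F')ᵀ * V) F) ↔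
      P ∈ lyapSet (aLTIState A B F') ∧ P ∈ lyapSet (aLTI A B C F) := by
  rw [aLTIState, mem_lyapSet_aLTI_iff A B 1 hF' hP, mem_lyapSet_aLTI_iff A B C hF hP,
    hMat_eq_cMat]
  set H := cMat A B (1 : Matrix (Fin n) (Fin n) ℝ) F'
  set Q := (piMat (K + 1) A B)ᵀ * xMat (K + 1) (K + 1) P 1 * piMat (K + 1) A B with hQ
  have hform : ∀ V z, z ⬝ᵥ ((Q + He (Hᵀ * V * cMat A B C F)) *ᵥ z)
      = z ⬝ᵥ (Q *ᵥ z) + 2 * ((H *ᵥ z) ⬝ᵥ (V *ᵥ (cMat A B C F *ᵥ z))) := fun V z => by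
    rw [Matrix.add_mulVec, dotProduct_add, dotProduct_He_mulVec,
      ← Matrix.mulVec_mulVec z (Hᵀ * V), ← Matrix.mulVec_mulVec _ Hᵀ,
      Matrix.dotProduct_mulVec z Hᵀ, Matrix.vecMul_transpose]
  constructor
  · rintro ⟨V, -, hV⟩
    have hneg : ∀ z, z ≠ 0 → z ⬝ᵥ ((Q + He (Hᵀ * V * cMat A B C F)) *ᵥ z) < 0 :=
      (negDef_iff.mp hV).2
    refine ⟨fun z hz hHz => ?_, fun z hz hCz => ?_⟩
    · have := hneg z hz
      rw [hform, hHz] at this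
      simpa using this
    · have := hneg z hz
      rw [hform, hCz] at this
      simpa using this
  · rintro ⟨h1, h2⟩
    obtain ⟨V, hV⟩ := exists_forall_dotProduct_neg Q H (cMat A B C F) h1 h2
    -- The half offsets the doubling of a quadratic form by `He`.
    refine ⟨(1 / 2 : ℝ) • V, hP, negDef_iff.mpr ⟨?_, fun z hz => ?_⟩⟩
    · have hsymm : Pᵀ = P := by simpa using hP.isHermitian.eq
      have hX : (xMat (K + 1) (K + 1) P 1)ᵀ = xMat (K + 1) (K + 1) P 1 := by
        rw [xMat, ← Matrix.kroneckerMap_transpose, hsymm]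
        simp [Matrix.transpose_vecMulVec]
      have hQs : Q.IsSymm := by
        simp [hQ, Matrix.IsSymm, hX, Matrix.mul_assoc]
      exact hQs.add (isSymm_He _)
    · have h3 := hV z hz
      rw [← hQ]
      rw [hform, Matrix.smul_mulVec, dotProduct_smul, smul_eq_mul]
      linarith

end Kernel

/-! ### Solutions of Ebihara's inequality -/

section Ebihara

variable {N n m : ℕ} {A : Matrix (Fin n) (Fin n) ℝ} {B : Matrix (Fin n) (Fin m) ℝ}
  {P : Matrix (Fin n) (Fin n) ℝ} {J : Matrix (Fin N × Fin m) (Fin N × Fin n) ℝ}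
  {G : Matrix (Fin N × Fin n) (Fin N × Fin n) ℝ}

theorem dotProduct_kronecker_mulVec {k l a b : ℕ} (M : Matrix (Fin k) (Fin l) ℝ)
    (A : Matrix (Fin a) (Fin b) ℝ) (ξ : Fin l × Fin a → ℝ) (y : Fin k × Fin b → ℝ) :
    ξ ⬝ᵥ ((Mᵀ ⊗ₖ A) *ᵥ y) = ((M ⊗ₖ Aᵀ) *ᵥ ξ) ⬝ᵥ y := by
  rw [Matrix.dotProduct_mulVec, ← Matrix.mulVec_transpose, ← Matrix.kroneckerMap_transpose,
    Matrix.transpose_transpose]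

theorem EbiharaLMI.form_neg (h : EbiharaLMI A B P J G) {ξ : Fin (N + 1) × Fin n → ℝ}
    (hξ : ξ ≠ 0) {η : Fin N × Fin n → ℝ} (hη : η = fun a => ξ (a.1.succ, a.2)) :
    ξ ⬝ᵥ (xMat N N P 1 *ᵥ ξ) + 2 * (((leftSel N (N + 1) ⊗ₖ Aᵀ) *ᵥ ξ) ⬝ᵥ (G *ᵥ η)
      + ((leftSel N (N + 1) ⊗ₖ Bᵀ) *ᵥ ξ) ⬝ᵥ (J *ᵥ η) - η ⬝ᵥ (G *ᵥ η)) < 0 := by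
  have hR : (rightSel N (N + 1) ⊗ₖ (1 : Matrix (Fin n) (Fin n) ℝ)) *ᵥ ξ = η := by
    rw [hη]
    ext ⟨i, r⟩
    rw [rightSel_kronecker_mulVec_apply, Matrix.one_mulVec]
  have := (negDef_iff.mp h.lmi).2 ξ hξ
  rw [Matrix.add_mulVec, dotProduct_add, dotProduct_He_mulVec, Matrix.sub_mulVec,
    Matrix.add_mulVec] at this
  simp only [← Matrix.mulVec_mulVec, hR, dotProduct_add, dotProduct_sub,
    dotProduct_kronecker_mulVec, Matrix.transpose_one] at this
  exact this

/-- The block vector with block `w` at position `k` and zeros elsewhere. -/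
def blockSingle {N n : ℕ} (k : Fin N) (w : Fin n → ℝ) : Fin N × Fin n → ℝ :=
  fun a => if a.1 = k then w a.2 else 0

theorem blockSingle_ne_zero {k : Fin N} {w : Fin n → ℝ} (hw : w ≠ 0) : blockSingle k w ≠ 0 :=
  fun h => hw (funext fun r => by simpa [blockSingle] using congrFun h (k, r))

theorem mulVec_blockSingle {a b : ℕ} (M : Matrix (Fin N × Fin a) (Fin N × Fin b) ℝ) (k : Fin N)
    (w : Fin b → ℝ) (i : Fin N) (r : Fin a) :
    (M *ᵥ blockSingle k w) (i, r) = ∑ s, M (i, r) (k, s) * w s := by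
  simp only [Matrix.mulVec, dotProduct, Fintype.sum_prod_type, blockSingle]
  rw [Finset.sum_eq_single k]
  · simp
  · intro j _ hj
    simp [hj]
  · simp

/-- The supports are disjoint: the left factor lives only in block `k + 1`, the right one only in
blocks up to `k`. -/
theorem leftSel_mulVec_blockSingle_dotProduct {a b : ℕ} (A : Matrix (Fin n) (Fin a) ℝ)
    {M : Matrix (Fin N × Fin a) (Fin N × Fin b) ℝ} (hM : IsBlockUpper M) (k : Fin N)
    (w : Fin n → ℝ) (v : Fin b → ℝ) :
    ((leftSel N (N + 1) ⊗ₖ Aᵀ) *ᵥ blockSingle k.succ w) ⬝ᵥ (M *ᵥ blockSingle k v) = 0 := by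
  refine Finset.sum_eq_zero fun q _ => ?_
  obtain ⟨i, r⟩ := q
  rcases lt_or_ge k i with hlt | hge
  · rw [mulVec_blockSingle]
    simp [hM i k hlt]
  · have hne : i.castSucc ≠ k.succ := fun h => by
      have := congrArg Fin.val h
      simp only [Fin.val_castSucc, Fin.val_succ] at this
      have := Fin.le_def.mp hge
      omega
    have h0 : (fun s => blockSingle k.succ w (i.castSucc, s)) = 0 :=
      funext fun s => if_neg hne
    rw [leftSel_kronecker_mulVec_apply, h0, Matrix.mulVec_zero, Pi.zero_apply, zero_mul]

/-- A vector supported in block `0` has zero trailing part, so the inequality reduces to `-wᵀPw <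
0`; `1 ≤ N` keeps the first and last blocks distinct. -/
theorem EbiharaLMI.dotProduct_mulVec_pos (h : EbiharaLMI A B P J G) (hN : 1 ≤ N)
    {w : Fin n → ℝ} (hw : w ≠ 0) : 0 < w ⬝ᵥ (P *ᵥ w) := by
  have hη : (0 : Fin N × Fin n → ℝ) = fun a => blockSingle (0 : Fin (N + 1)) w (a.1.succ, a.2) :=
    funext fun a => (if_neg (Fin.succ_ne_zero a.1)).symm
  have h1 := h.form_neg (blockSingle_ne_zero (k := (0 : Fin (N + 1))) hw) hη
  have h0 : (fun r => blockSingle (0 : Fin (N + 1)) w (0, r)) = w := funext fun r => if_pos rfl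
  have hlast : (fun r => blockSingle (0 : Fin (N + 1)) w (Fin.last N, r)) = 0 :=
    funext fun r => if_neg fun h => by
      have := congrArg Fin.val h
      simp only [Fin.val_last, Fin.val_zero] at this
      omega
  rw [dotProduct_xMat_mulVec, h0, hlast] at h1
  simpa using h1

/-- On a vector supported in block `k + 1` the terms with `A` and `B` vanish and the `𝒳(P)` term is
nonnegative, which leaves only the diagonal block of `𝓖` to make the form negative. -/
theorem EbiharaLMI.diag_block_dotProduct_pos (h : EbiharaLMI A B P J G) (hN : 1 ≤ N) (k : Fin N)
    {w : Fin n → ℝ} (hw : w ≠ 0) :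
    0 < blockSingle k w ⬝ᵥ (G *ᵥ blockSingle k w) := by
  have hη : blockSingle k w = fun a => blockSingle k.succ w (a.1.succ, a.2) :=
    funext fun a => by simp [blockSingle]
  have h1 := h.form_neg (blockSingle_ne_zero (k := k.succ) hw) hη
  rw [leftSel_mulVec_blockSingle_dotProduct A h.upperG,
    leftSel_mulVec_blockSingle_dotProduct B h.upperJ, dotProduct_xMat_mulVec] at h1
  have h0 : (fun r => blockSingle k.succ w (0, r)) = 0 :=
    funext fun r => if_neg (Fin.succ_ne_zero k).symm
  have hlast : 0 ≤ (fun r => blockSingle k.succ w (Fin.last N, r)) ⬝ᵥ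
      (P *ᵥ fun r => blockSingle k.succ w (Fin.last N, r)) := by
    by_cases hx : (fun r => blockSingle k.succ w (Fin.last N, r)) = 0
    · simp [hx]
    · exact (h.dotProduct_mulVec_pos hN hx).le
  rw [h0, zero_dotProduct] at h1
  linarith

/-- Back substitution from the last block: once the later blocks of a kernel vector vanish, block
row `k` says that the diagonal block kills `η_k`, so positivity forces `η_k = 0`. -/
theorem EbiharaLMI.det_ne_zero (h : EbiharaLMI A B P J G) (hN : 1 ≤ N) : G.det ≠ 0 := by
  intro hdet
  obtain ⟨η, hη0, hη⟩ := Matrix.exists_mulVec_eq_zero_iff.mpr hdet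
  refine hη0 ?_
  suffices ∀ k : Fin N, (fun r => η (k, r)) = 0 by
    ext ⟨k, r⟩
    exact congrFun (this k) r
  intro k
  induction k using WellFoundedGT.induction with
  | _ k ih =>
    by_contra hw
    refine (h.diag_block_dotProduct_pos hN k hw).ne' ?_
    refine Finset.sum_eq_zero fun q _ => ?_
    obtain ⟨i, r⟩ := q
    by_cases hik : i = k
    · subst hik
      have h1 : (G *ᵥ blockSingle i fun r => η (i, r)) (i, r) = (G *ᵥ η) (i, r) := by
        refine Finset.sum_congr rfl fun a _ => ?_
        obtain ⟨j, s⟩ := a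
        rcases lt_trichotomy j i with hj | rfl | hj
        · simp only [h.upperG i j hj, zero_mul]
        · simp [blockSingle]
        · have : η (j, s) = 0 := congrFun (ih j hj) s
          simp [blockSingle, hj.ne', this]
      rw [h1, hη, Pi.zero_apply, mul_zero]
    · simp [blockSingle, hik]

theorem IsBlockUpper.inv (hG : IsBlockUpper G) (hdet : G.det ≠ 0) : IsBlockUpper G⁻¹ := by
  have : Invertible G := G.invertibleOfIsUnitDet hdet.isUnit
  have hb : G.BlockTriangular Prod.fst := fun a b hab => hG a.1 b.1 hab a.2 b.2
  exact fun i j hij r c => Matrix.blockTriangular_inv_of_blockTriangular hb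
    (i := (i, r)) (j := (j, c)) hij

theorem IsBlockUpper.mul {a b c : ℕ} {X : Matrix (Fin N × Fin a) (Fin N × Fin b) ℝ}
    {Y : Matrix (Fin N × Fin b) (Fin N × Fin c) ℝ} (hX : IsBlockUpper X) (hY : IsBlockUpper Y) :
    IsBlockUpper (X * Y) := fun i j hij r s => by
  rw [Matrix.mul_apply]
  refine Finset.sum_eq_zero fun q _ => ?_
  obtain ⟨k, t⟩ := q
  rcases lt_or_ge k i with hk | hk
  · rw [hX i k hk, zero_mul]
  · rw [hY k j (hij.trans_le hk), mul_zero]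

theorem flip_apply (i j : Fin N) : flip N i j = if j = i.rev then 1 else 0 := by
  rw [flip, Matrix.of_apply]
  refine if_congr ?_ rfl rfl
  rw [Fin.ext_iff, Fin.val_rev]
  omega

theorem flip_kronecker_mul_mul_flip_kronecker {a b : ℕ}
    (X : Matrix (Fin N × Fin a) (Fin N × Fin b) ℝ) :
    (flip N ⊗ₖ (1 : Matrix (Fin a) (Fin a) ℝ)) * X * (flip N ⊗ₖ (1 : Matrix (Fin b) (Fin b) ℝ))
      = X.submatrix (fun q => (q.1.rev, q.2)) (fun q => (q.1.rev, q.2)) := by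
  have hrev : ∀ i j : Fin N, j = i.rev ↔ i = j.rev := fun i j => by
    rw [eq_comm, Fin.rev_eq_iff]
  ext ⟨i, r⟩ ⟨j, c⟩
  simp [Matrix.mul_apply, Fintype.sum_prod_type, flip_apply, Matrix.one_apply, hrev _ j]

/-- Multiplying by the flips on both sides reverses the order of block rows and columns, exchanging
upper and lower triangular. -/
theorem EbiharaLMI.isBlockLower_stateGain (h : EbiharaLMI A B P J G) (hN : 1 ≤ N) :
    IsBlockLower (stateGain J G) := by
  have hJG := h.upperJ.mul (h.upperG.inv (h.det_ne_zero hN))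
  intro i j hij r c
  rw [stateGain, Matrix.mul_assoc _ J, flip_kronecker_mul_mul_flip_kronecker]
  exact hJG _ _ (Fin.rev_lt_rev.mpr hij) r c

end Ebihara

end PTVM

theorem theorem2 (N n m p : ℕ) (hN : 1 ≤ N)
    (A : Matrix (Fin n) (Fin n) ℝ) (B : Matrix (Fin n) (Fin m) ℝ) (C : Matrix (Fin p) (Fin n) ℝ)
    (Phat : Matrix (Fin n) (Fin n) ℝ) (Jhat : Matrix (Fin N × Fin m) (Fin N × Fin n) ℝ)
    (Ghat : Matrix (Fin N × Fin n) (Fin N × Fin n) ℝ)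
    (hsol : PTVM.EbiharaLMI A B Phat Jhat Ghat) :
    (∃ (P : Matrix (Fin n) (Fin n) ℝ)
       (V : Matrix ((Fin N × Fin m) ⊕ (Fin (N - 1) × Fin n))
         ((Fin N × Fin m) ⊕ (Fin (N - 1) × Fin n)) ℝ),
       ∃ F ∈ Set.range (PTVM.gainDown (N := N) (m := m) (p := p)),
         PTVM.BMI A B C P ((PTVM.hMat A B (PTVM.stateGain Jhat Ghat))ᵀ * V) F) ↔
      (PTVM.lyapSet (PTVM.aLTIState A B (PTVM.stateGain Jhat Ghat)) ∩
        PTVM.lyapSOF N A B C).Nonempty := by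
  have hSF := hsol.isBlockLower_stateGain hN
  obtain ⟨K, rfl⟩ : ∃ K, N = K + 1 := ⟨N - 1, (Nat.sub_add_cancel hN).symm⟩
  constructor
  · rintro ⟨P, V, _, ⟨F, rfl⟩, hBMI⟩
    obtain ⟨h1, h2⟩ := (PTVM.exists_BMI_iff A B C hBMI.1 (PTVM.isBlockLower_gainDown F) hSF).mp
      ⟨V, hBMI⟩
    exact ⟨P, h1, Set.mem_iUnion₂.mpr
      ⟨_, ⟨⟨F, rfl⟩, PTVM.spectralRadius_lt_one_of_mem_lyapSet h2⟩, h2⟩⟩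
  · rintro ⟨P, h1, h2⟩
    obtain ⟨_, ⟨⟨F, rfl⟩, -⟩, h3⟩ := Set.mem_iUnion₂.mp h2
    obtain ⟨V, hV⟩ := (PTVM.exists_BMI_iff A B C h1.1 (PTVM.isBlockLower_gainDown F) hSF).mpr
      ⟨h1, h3⟩
    exact ⟨P, V, _, ⟨F, rfl⟩, hV⟩
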